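/- Let $R$ be an integral domain with field of fractions $K$. An ideal $I$ of $R$ is called stable if $I$ is projective as a module over its endomorphism ring $\operatorname{End}_R(I)$. The domain $R$ is called stable if every nonzero ideal of $R$ is stable, and finitely stable if every nonzero finitely generated ideal of $R$ is stable. For $R$-submodules $A,B$ of $K$ put $(A:B)=\{x\in K \mid xB\subseteq A\}$. An ideal $I$ of $R$ is called divisorial if $I\neq(0)$ and $I=(R:(R:I))$, and $R$ is called a Mori domain if it satisfies the ascending chain condition on divisorial ideals. Proposition. If $R$ has Krull dimension one and is a finitely stable Mori domain, then $R$ is stable. -/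

import Mathlib

/-- An ideal `I` of a commutative ring `R` is *stable* if it is projective as a module over its
endomorphism ring `End_R(I)`, which acts on `I` by evaluation, `f • x = f x`. -/
def Ideal.IsStable {R : Type*} [CommRing R] (I : Ideal R) : Prop :=
  Module.Projective (Module.End R I) I

/-- A domain is *stable* if each of its nonzero ideals is stable. -/
def IsStableDomain (R : Type*) [CommRing R] [IsDomain R] : Prop :=
  ∀ I : Ideal R, I ≠ ⊥ → I.IsStable

/-- A domain is *finitely stable* if each of its nonzero finitely generated ideals is stable. -/
def IsFinitelyStableDomain (R : Type*) [CommRing R] [IsDomain R] : Prop :=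
  ∀ I : Ideal R, I ≠ ⊥ → I.FG → I.IsStable

/-- The divisorial closure `I_v = (R : (R : I))` of an ideal `I` of a domain `R`, computed in the
field of fractions `K` of `R`; here `(A : B) = A / B = {x ∈ K | x B ⊆ A}` for `R`-submodules
`A`, `B` of `K`, and `1` is the submodule `R` of `K`. -/
noncomputable def Ideal.vClosure {R : Type*} [CommRing R] [IsDomain R] (I : Ideal R) :
    Submodule R (FractionRing R) :=
  1 / (1 / IsLocalization.coeSubmodule (FractionRing R) I)

/-- An ideal `I` of a domain is *divisorial* if `I ≠ 0` and `I = I_v`. -/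
def Ideal.IsDivisorial {R : Type*} [CommRing R] [IsDomain R] (I : Ideal R) : Prop :=
  I ≠ ⊥ ∧ IsLocalization.coeSubmodule (FractionRing R) I = I.vClosure

/-- A domain is a *Mori domain* if it satisfies the ascending chain condition on divisorial
ideals: every ascending sequence of divisorial ideals is eventually constant. -/
def IsMoriDomain (R : Type*) [CommRing R] [IsDomain R] : Prop :=
  ∀ J : ℕ → Ideal R, Monotone J → (∀ n, (J n).IsDivisorial) → ∃ n, ∀ m, n ≤ m → J m = J n

/-!
Write `(A : B)` for `A / B` inside the field of fractions `K`, and `E(X) = (X : X)`. Multiplication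
identifies `End_R(I)` with `E(I)`, and a dual basis argument shows that a nonzero ideal `I` is
stable if and only if `I` is invertible over `E(I)`, that is, `1 ∈ I (I : I²)`
(`Ideal.IsStable.one_mem`, `Ideal.isStable_of_one_mem`).

Let `I` be a nonzero ideal. The chain condition on divisorial ideals yields a nonzero finitely
generated `J₀ ⊆ I` with `(R : J₀) = (R : I)` (`IsMoriDomain.exists_fg_one_div_eq`). Then all
ideals `J` between `J₀` and `I` have the same divisorial closure `V`. Put `T = E(V)`. Since `J₀` is
invertible over its endomorphism ring, `V = J₀ T` (`Submodule.div_div_le_mul_of_one_mem`).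

The central point is that `J = J₀ E(J)` for each finitely generated `J` between `J₀` and `I`
(`Submodule.eq_mul_div_self_of_one_div_eq`). As `J` is invertible over `E(J)`, this means that the
ideal `A = J₀ (J : J²)` of `E(J)` is all of `E(J)`. It does satisfy `1 ∈ A T`, and `T` is contained
in `d⁻¹ R` for some `d ≠ 0`. Replacing `A` by a finitely generated subideal with the same property,
`d T ⊆ Aⁿ` for every `n`. But `E(J)` is integral over `R`, hence of dimension at most one, and in
such a domain a proper finitely generated ideal has no nonzero element in all its powers
(`Ideal.eq_top_of_forall_mem_pow`).

Finally `(J₀ : J₀²) ⊆ (I : I²)`: for `x, y ∈ I` and `J = J₀ + Rx + Ry`, the equality `J = J₀ E(J)`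
gives `(J₀ : J₀²) xy ⊆ (J₀ : J₀²) J₀² E(J) ⊆ J₀ E(J) = J ⊆ I`. Hence
`1 ∈ J₀ (J₀ : J₀²) ⊆ I (I : I²)` and `I` is stable (`Submodule.one_mem_mul_stableInv_of_fg`).
-/

/-! ### Powers of finitely generated ideals in one-dimensional domains -/

/-- In a domain of dimension at most one, a proper finitely generated ideal has no nonzero element
in all of its powers. After localizing at a maximal ideal containing `A`, some power of `A` is
contained in `(d)`, hence in all powers of `A`, so it is idempotent, which is impossible. -/
theorem Ideal.eq_top_of_forall_mem_pow {B : Type*} [CommRing B] [IsDomain B]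
    [Ring.DimensionLEOne B] {A : Ideal B} (hA : A.FG) {d : B} (hd : d ≠ 0)
    (h : ∀ n : ℕ, d ∈ A ^ n) : A = ⊤ := by
  by_contra hne
  obtain ⟨N, hN, hAN⟩ := A.exists_le_maximal hne
  have hdN : d ∈ N := hAN (by simpa using h 1)
  have hNmin : N ∈ (Ideal.span {d}).minimalPrimes := by
    refine ⟨⟨hN.isPrime, (Ideal.span_singleton_le_iff_mem _).2 hdN⟩, fun P hP hPN => ?_⟩
    have hP0 : P ≠ ⊥ := by
      rintro rfl
      exact hd (by simpa using hP.2)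
    have := hP.1.isMaximal hP0
    exact (this.eq_of_le hN.ne_top hPN).ge
  set L := Localization.AtPrime N
  have hinj : Function.Injective (algebraMap B L) :=
    IsLocalization.injective L N.primeCompl_le_nonZeroDivisors
  have : IsDomain L := IsLocalization.isDomain_localization N.primeCompl_le_nonZeroDivisors
  have hrad := IsLocalization.AtPrime.radical_map_of_mem_minimalPrimes L N (Ideal.span {d}) hNmin
  have hfg : (A.map (algebraMap B L)).FG := hA.map _
  obtain ⟨n, hn⟩ := Ideal.exists_pow_le_of_le_radical_of_fg
    ((Ideal.map_mono hAN).trans hrad.ge) hfg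
  have hdk (k : ℕ) : (Ideal.span {d}).map (algebraMap B L) ≤ A.map (algebraMap B L) ^ k := by
    rw [← Ideal.map_pow]
    exact Ideal.map_mono ((Ideal.span_singleton_le_iff_mem _).2 (h k))
  have hidem : IsIdempotentElem (A.map (algebraMap B L) ^ n) :=
    le_antisymm Ideal.mul_le_left (hn.trans ((hdk (n + n)).trans (pow_add _ n n).le))
  rcases (Ideal.isIdempotentElem_iff_eq_bot_or_top _ hfg.pow).1 hidem with h0 | h1
  · have : algebraMap B L d ∈ (⊥ : Ideal L) :=
      h0 ▸ hdk n (Ideal.mem_map_of_mem _ (Ideal.mem_span_singleton_self d))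
    exact hd (hinj (by simpa using this))
  · refine (IsLocalRing.maximalIdeal.isMaximal L).ne_top (top_le_iff.1 ?_)
    rw [← IsLocalization.AtPrime.map_eq_maximalIdeal N L, ← h1]
    exact hn.trans ((hdk 1).trans ((pow_one _).le.trans (Ideal.map_mono hAN)))

/-! ### Submodules that are invertible over their endomorphism ring -/

section Fractional

variable {R K : Type*} [CommRing R] [Field K] [Algebra R K]

theorem Submodule.div_le_div_left (Z : Submodule R K) {X Y : Submodule R K} (h : X ≤ Y) :
    Z / Y ≤ Z / X :=
  Submodule.le_div_iff_mul_le.2 ((mul_le_mul_right h _).trans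
    (Submodule.le_div_iff_mul_le.1 le_rfl))

theorem Submodule.le_one_div_one_div (X : Submodule R K) : X ≤ 1 / (1 / X) := by
  rw [Submodule.le_div_iff_mul_le, mul_comm]
  exact Submodule.le_div_iff_mul_le.1 le_rfl

/-- The module `(X : X²)`, which is the inverse of `X` over the ring `(X : X)` whenever such an
inverse exists. -/
def Submodule.stableInv (X : Submodule R K) : Submodule R K := X / (X * X)

theorem Submodule.mul_div_self_le (X : Submodule R K) : X * (X / X) ≤ X := by
  rw [mul_comm]
  exact Submodule.le_div_iff_mul_le.1 le_rfl

theorem Submodule.stableInv_mul_mul_le (X : Submodule R K) : X.stableInv * (X * X) ≤ X :=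
  Submodule.le_div_iff_mul_le.1 le_rfl

theorem Submodule.mem_stableInv {X : Submodule R K} {q : K} :
    q ∈ X.stableInv ↔ ∀ x ∈ X, ∀ y ∈ X, q * (x * y) ∈ X := by
  refine ⟨fun h x hx y hy => Submodule.mem_div_iff_forall_mul_mem.1 h _
    (Submodule.mul_mem_mul hx hy), fun h => Submodule.mem_div_iff_forall_mul_mem.2 fun z hz => ?_⟩
  induction hz using Submodule.mul_induction_on' with
  | add a _ b _ ha hb => rw [mul_add]; exact X.add_mem ha hb
  | mem_mul_mem x hx y hy => exact h x hx y hy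

theorem Submodule.mul_stableInv_le_div_self (X : Submodule R K) : X * X.stableInv ≤ X / X := by
  rw [Submodule.le_div_iff_mul_le]
  calc X * X.stableInv * X = X.stableInv * (X * X) := by ring
    _ ≤ X := X.stableInv_mul_mul_le

theorem Submodule.div_self_mul_stableInv_le (X : Submodule R K) :
    X / X * X.stableInv ≤ X.stableInv := by
  refine Submodule.le_div_iff_mul_le.2 ?_
  calc X / X * X.stableInv * (X * X) = X.stableInv * (X * X) * (X / X) := by ring
    _ ≤ X * (X / X) := mul_le_mul_left X.stableInv_mul_mul_le _
    _ ≤ X := X.mul_div_self_le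

/-- The module `(X : X)` as a subalgebra of `K`; for a nonzero ideal `X` of a domain with field of
fractions `K` it is the endomorphism ring of `X`. -/
def Submodule.divSelf (X : Submodule R K) : Subalgebra R K :=
  (X / X).toSubalgebra (Submodule.one_mem_div.2 le_rfl) fun x y hx hy => by
    rw [Submodule.mem_div_iff_forall_mul_mem] at hx hy ⊢
    intro z hz
    rw [mul_assoc]
    exact hx _ (hy z hz)

theorem Submodule.FG.isIntegral_divSelf {X : Submodule R K} (hX : X.FG) (h0 : X ≠ ⊥) :
    Algebra.IsIntegral R X.divSelf := by
  refine ⟨fun b => ?_⟩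
  rw [← isIntegral_algHom_iff X.divSelf.val Subtype.val_injective]
  exact isIntegral_of_smul_mem_submodule X h0 hX b.1
    (Submodule.mem_div_iff_forall_mul_mem.1 b.2)

open scoped Pointwise in
/-- Let `A` be an ideal of the ring `(X : X)`, where `X` is finitely generated over `R`. If `A`
becomes the unit ideal in a ring `T` that has a nonzero conductor into `(X : X)`, then `A` is
already the unit ideal. -/
theorem Submodule.one_mem_of_one_mem_mul [Ring.DimensionLEOne R] [IsDomain R]
    [FaithfulSMul R K] {X A : Submodule R K} (hX : X.FG) (hX0 : X ≠ ⊥) (hA : A ≤ X / X)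
    (hXA : X / X * A ≤ A) (T : Subalgebra R K) {d : R} (hd : d ≠ 0)
    (hdT : ∀ t ∈ T, algebraMap R K d * t ∈ X / X) (h1 : 1 ∈ A * T.toSubmodule) : 1 ∈ A := by
  have := hX.isIntegral_divSelf hX0
  have : Ring.DimensionLEOne X.divSelf := Ring.DimensionLEOne.of_isIntegral R _
  -- Only the finitely many elements of `A` that occur in a representation of `1` matter.
  obtain ⟨S, S', hSA, hST, h1⟩ := Submodule.mem_span_mul_finite_of_mem_mul h1
  set s : Set X.divSelf := Subtype.val ⁻¹' (S : Set K)
  have hs : s.Finite := S.finite_toSet.preimage Subtype.val_injective.injOn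
  -- `d T` lies in every power of the ideal: multiply `d t` by the chosen representation of `1`.
  have key : ∀ n : ℕ, ∀ t ∈ T, ∃ b ∈ (Ideal.span s) ^ n, (b : K) = algebraMap R K d * t := by
    intro n
    induction n with
    | zero => exact fun t ht => ⟨⟨_, hdT t ht⟩, by simp, rfl⟩
    | succ n ih =>
      intro t ht
      have : ∀ z ∈ Submodule.span R ((S : Set K) * (S' : Set K)),
          ∃ b ∈ (Ideal.span s) ^ (n + 1), (b : K) = algebraMap R K d * (z * t) := by
        intro z hz
        induction hz using Submodule.span_induction with
        | mem z hz =>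
          obtain ⟨a, ha, u, hu, rfl⟩ := Set.mem_mul.1 hz
          obtain ⟨b, hb, hbe⟩ := ih (u * t) (T.mul_mem (hST hu) ht)
          refine ⟨⟨a, hA (hSA ha)⟩ * b, ?_, ?_⟩
          · rw [pow_succ']
            exact Ideal.mul_mem_mul (Ideal.subset_span ha) hb
          · simp only [MulMemClass.coe_mul, hbe]
            ring
        | zero => exact ⟨0, zero_mem _, by simp⟩
        | add x y _ _ hx hy =>
          obtain ⟨b, hb, hbe⟩ := hx
          obtain ⟨c, hc, hce⟩ := hy
          exact ⟨b + c, add_mem hb hc, by simp only [AddMemClass.coe_add, hbe, hce]; ring⟩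
        | smul r x _ hx =>
          obtain ⟨b, hb, hbe⟩ := hx
          refine ⟨r • b, Submodule.smul_of_tower_mem _ r hb, ?_⟩
          rw [Subalgebra.coe_smul, hbe, smul_mul_assoc, mul_smul_comm]
      simpa using this 1 h1
  have htop : Ideal.span s = ⊤ := by
    refine Ideal.eq_top_of_forall_mem_pow (d := algebraMap R X.divSelf d)
      ⟨hs.toFinset, by simp⟩ ?_ fun n => ?_
    · exact fun h => hd (FaithfulSMul.algebraMap_injective R K
        (by simpa using congrArg Subtype.val h))
    · obtain ⟨b, hb, hbe⟩ := key n 1 T.one_mem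
      rw [mul_one] at hbe
      convert hb
      exact Subtype.ext hbe.symm
  have : ∀ b ∈ Ideal.span s, (b : K) ∈ A := by
    intro b hb
    induction hb using Submodule.span_induction with
    | mem z hz => exact hSA hz
    | zero => exact A.zero_mem
    | add x y _ _ hx hy => exact A.add_mem hx hy
    | smul r x _ hx => exact hXA (Submodule.mul_mem_mul r.2 hx)
  exact this 1 (htop ▸ Submodule.mem_top)

/-- If `J` is invertible over `(J : J)`, with divisorial closure `V = (R : (R : J))`, then
`V` is generated by `J` over the ring `(V : V)`. -/
theorem Submodule.div_div_le_mul_of_one_mem {J : Submodule R K} (hJ : 1 ∈ J * J.stableInv) :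
    1 / (1 / J) ≤ J * (1 / (1 / J) / (1 / (1 / J))) := by
  set D := 1 / J
  have hV : 1 / D * D ≤ 1 := Submodule.le_div_iff_mul_le.1 le_rfl
  have hDJ : D * J ≤ 1 := Submodule.le_div_iff_mul_le.1 le_rfl
  have h1 : J.stableInv * J * D ≤ D := by
    refine Submodule.le_div_iff_mul_le.2 ?_
    calc J.stableInv * J * D * J = J.stableInv * (J * J) * D := by ring
      _ ≤ J * D := mul_le_mul_left J.stableInv_mul_mul_le _
      _ ≤ 1 := (mul_comm _ _).trans_le hDJ
  have h2 : J.stableInv * D * (1 / D) ≤ D := by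
    refine Submodule.le_div_iff_mul_le.2 ?_
    calc J.stableInv * D * (1 / D) * J = 1 / D * (J.stableInv * J * D) := by ring
      _ ≤ 1 / D * D := mul_le_mul_right h1 _
      _ ≤ 1 := hV
  have h3 : J.stableInv * (1 / D) ≤ 1 / D / (1 / D) := by
    refine Submodule.le_div_iff_mul_le.2 (Submodule.le_div_iff_mul_le.2 ?_)
    calc J.stableInv * (1 / D) * (1 / D) * D = 1 / D * (J.stableInv * D * (1 / D)) := by ring
      _ ≤ 1 / D * D := mul_le_mul_right h2 _
      _ ≤ 1 := hV
  calc 1 / D = 1 * (1 / D) := (one_mul _).symm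
    _ ≤ J * J.stableInv * (1 / D) := mul_le_mul_left (Submodule.one_le.2 hJ) _
    _ = J * (J.stableInv * (1 / D)) := mul_assoc _ _ _
    _ ≤ _ := mul_le_mul_right h3 _

/-- If `J₀ ⊆ J` are ideals of `R` with the same divisorial closure, both invertible over their
endomorphism rings, and if `J` is finitely generated, then `J₀` generates `J` over the
endomorphism ring of `J`. -/
theorem Submodule.eq_mul_div_self_of_one_div_eq [Ring.DimensionLEOne R] [IsDomain R]
    [FaithfulSMul R K] {J₀ J : Submodule R K} (h0 : J₀ ≠ ⊥) (h : J₀ ≤ J) (hJ1 : J ≤ 1)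
    (hJ : J.FG) (hs0 : 1 ∈ J₀ * J₀.stableInv) (hs : 1 ∈ J * J.stableInv)
    (hD : 1 / J₀ = 1 / J) : J = J₀ * (J / J) := by
  have hJ0 : J ≠ ⊥ := fun e => h0 (le_bot_iff.1 (h.trans e.le))
  set V := 1 / (1 / J₀) with hV
  have hJV : J ≤ V := by
    rw [hV, hD]
    exact Submodule.le_one_div_one_div J
  have hV1 : V ≤ 1 := by
    have : V * 1 ≤ V * (1 / J₀) :=
      mul_le_mul_right (Submodule.one_le_one_div.2 (h.trans hJ1)) _
    rw [mul_one] at this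
    exact this.trans (Submodule.le_div_iff_mul_le.1 le_rfl)
  have h1E : (1 : Submodule R K) ≤ J / J := Submodule.one_le.2 (Submodule.one_mem_div.2 le_rfl)
  obtain ⟨x, hx, hx0⟩ := (Submodule.ne_bot_iff _).1 h0
  obtain ⟨d, rfl⟩ := Submodule.mem_one.1 (hJ1 (h hx))
  -- The ideal `J₀ (J : J²)` of `(J : J)` becomes the unit ideal in `(V : V)`, and `d ∈ J₀` is a
  -- conductor because `d (V : V) ⊆ V ⊆ R`.
  have key : (1 : K) ∈ J₀ * J.stableInv := by
    refine Submodule.one_mem_of_one_mem_mul (d := d) hJ hJ0 ?_ ?_ V.divSelf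
      (fun e => hx0 (by simp [e])) ?_ ?_
    · exact (mul_le_mul_left h _).trans J.mul_stableInv_le_div_self
    · calc J / J * (J₀ * J.stableInv) = J₀ * (J / J * J.stableInv) := by ring
        _ ≤ _ := mul_le_mul_right J.div_self_mul_stableInv_le _
    · intro t ht
      refine h1E (hV1 ?_)
      rw [mul_comm]
      exact Submodule.mem_div_iff_forall_mul_mem.1 ht _ (hJV (h hx))
    · have : J * J.stableInv ≤ J₀ * J.stableInv * (V / V) :=
        calc J * J.stableInv ≤ J₀ * (V / V) * J.stableInv :=
              mul_le_mul_left (hJV.trans (Submodule.div_div_le_mul_of_one_mem hs0)) _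
          _ = J₀ * J.stableInv * (V / V) := by ring
      exact this hs
  refine le_antisymm ?_ ((mul_le_mul_left h _).trans J.mul_div_self_le)
  calc J = 1 * J := (one_mul _).symm
    _ ≤ J₀ * J.stableInv * J := mul_le_mul_left (Submodule.one_le.2 key) _
    _ = J₀ * (J * J.stableInv) := by ring
    _ ≤ J₀ * (J / J) := mul_le_mul_right J.mul_stableInv_le_div_self _

/-- Invertibility over the endomorphism ring passes from the finitely generated ideals inside `I` to
`I`, provided that `I` has the same divisorial closure as a finitely generated `J₀ ⊆ I`. -/
theorem Submodule.one_mem_mul_stableInv_of_fg [Ring.DimensionLEOne R] [IsDomain R]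
    [FaithfulSMul R K] {J₀ I : Submodule R K} (h0 : J₀ ≠ ⊥) (hJ₀ : J₀.FG) (h : J₀ ≤ I)
    (hI : I ≤ 1) (hD : 1 / J₀ = 1 / I)
    (hs : ∀ J : Submodule R K, J ≠ ⊥ → J ≤ I → J.FG → 1 ∈ J * J.stableInv) :
    1 ∈ I * I.stableInv := by
  have hs0 := hs J₀ h0 h hJ₀
  suffices hle : J₀.stableInv ≤ I.stableInv from mul_le_mul' h hle hs0
  intro q hq
  refine Submodule.mem_stableInv.2 fun x hx y hy => ?_
  -- It suffices to test `(J₀ : J₀²) x y ⊆ I` inside the finitely generated ideal `J₀ + Rx + Ry`.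
  set J := J₀ ⊔ Submodule.span R {x, y}
  have hJI : J ≤ I := sup_le h (Submodule.span_le.2 (by
    rintro _ (rfl | rfl) <;> assumption))
  have hJ₀J : J₀ ≤ J := le_sup_left
  have hxyJ : Submodule.span R {x, y} ≤ J := le_sup_right
  have hxJ : x ∈ J := hxyJ (Submodule.subset_span (by simp))
  have hyJ : y ∈ J := hxyJ (Submodule.subset_span (by simp))
  have hJ : J.FG := hJ₀.sup (Submodule.fg_span (by simp))
  have hJ0 : J ≠ ⊥ := fun e => h0 (le_bot_iff.1 (hJ₀J.trans e.le))
  have hDJ : 1 / J₀ = 1 / J :=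
    le_antisymm (hD.trans_le (Submodule.div_le_div_left 1 hJI)) (Submodule.div_le_div_left 1 hJ₀J)
  have hJE := Submodule.eq_mul_div_self_of_one_div_eq h0 hJ₀J (hJI.trans hI) hJ hs0
    (hs J hJ0 hJI hJ) hDJ
  have : J₀.stableInv * (J * J) ≤ J :=
    calc J₀.stableInv * (J * J) = J₀.stableInv * (J₀ * (J / J) * J) := by rw [← hJE]
      _ = J₀.stableInv * (J₀ * (J * (J / J))) := by ring
      _ ≤ J₀.stableInv * (J₀ * J) :=
        mul_le_mul_right (mul_le_mul_right J.mul_div_self_le _) _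
      _ = J₀.stableInv * (J₀ * (J₀ * (J / J))) := by rw [← hJE]
      _ = J₀.stableInv * (J₀ * J₀) * (J / J) := by ring
      _ ≤ J₀ * (J / J) := mul_le_mul_left J₀.stableInv_mul_mul_le _
      _ = J := hJE.symm
  exact hJI (this (Submodule.mul_mem_mul hq (Submodule.mul_mem_mul hxJ hyJ)))

end Fractional

/-! ### Stability as invertibility -/

section Stable

variable {R : Type*} [CommRing R]

open IsLocalization

/-- Both sides are `f (x * z)`. This identity makes the endomorphisms of an ideal of a domain
multiplications by elements of the field of fractions. -/
theorem Ideal.end_apply_mul_eq {I : Ideal R} (f : Module.End R I) (x z : I) :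
    (f x : R) * z = x * f z := by
  have h : z.1 • f x = x.1 • f z := by
    rw [← map_smul, ← map_smul]
    exact congrArg f (Subtype.ext (mul_comm _ _))
  simpa [mul_comm] using congrArg Subtype.val h

variable (K : Type*) [Field K] [Algebra R K]

theorem Ideal.coeSubmodule_le_one (I : Ideal R) : coeSubmodule K I ≤ 1 := by
  rw [← coeSubmodule_top]
  exact coeSubmodule_mono _ le_top

variable [IsFractionRing R K]

theorem Ideal.exists_forall_end_apply_eq {I : Ideal R} (f : Module.End R I) :
    ∃ e : K, ∀ z : I, algebraMap R K (f z) = e * algebraMap R K z := by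
  by_cases hI : I = ⊥
  · subst hI
    exact ⟨0, fun z => by
      rw [(Submodule.mem_bot R).1 (f z).2, map_zero, zero_mul]⟩
  obtain ⟨x, hx, hx0⟩ := (Submodule.ne_bot_iff _).1 hI
  refine ⟨algebraMap R K (f ⟨x, hx⟩) / algebraMap R K x, fun z => ?_⟩
  have hx0' : algebraMap R K x ≠ 0 := fun e =>
    hx0 (IsFractionRing.injective R K (by simpa using e))
  rw [div_mul_eq_mul_div, eq_div_iff hx0', ← map_mul, ← map_mul, mul_comm]
  exact congrArg _ (Ideal.end_apply_mul_eq f ⟨x, hx⟩ z).symm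

/-- A nonzero stable ideal is invertible over its endomorphism ring. The functionals of a dual basis
of `I` over `End_R(I)` are multiplications by elements of `(I : I²)`. -/
theorem Ideal.IsStable.one_mem {I : Ideal R} (hI : I ≠ ⊥) (h : I.IsStable) :
    1 ∈ coeSubmodule K I * (coeSubmodule K I).stableInv := by
  obtain ⟨s, hs⟩ := Module.projective_def.1 h
  obtain ⟨x, hx, hx0⟩ := (Submodule.ne_bot_iff _).1 hI
  set a := algebraMap R K
  have hinj : Function.Injective a := IsFractionRing.injective R K
  have hx0' : a x ≠ 0 := fun e => hx0 (hinj (by simpa using e))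
  -- The dual basis: the functional `u ↦ s u y` is multiplication by `q y`.
  let q : I → K := fun y => a (s ⟨x, hx⟩ y ⟨x, hx⟩) / (a x * a x)
  have hq (y u v : I) : q y * (a u * a v) = a (s u y v) := by
    have h1 : (s ⟨x, hx⟩ y ⟨x, hx⟩ : R) * v = x * s ⟨x, hx⟩ y v :=
      Ideal.end_apply_mul_eq _ _ _
    have h2 : (u : R) • s ⟨x, hx⟩ = x • s u := by
      have e (r : R) (w : I) : r • s w = s (r • w) := by
        have := s.map_smul (algebraMap R (Module.End R I) r) w
        rw [Module.End.smul_def, Module.algebraMap_end_apply] at this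
        rw [this]
        ext y : 1
        rw [Finsupp.smul_apply, Finsupp.smul_apply, Algebra.smul_def, smul_eq_mul]
      rw [e, e]
      exact congrArg s (Subtype.ext (mul_comm _ _))
    have h3 : (u : R) * s ⟨x, hx⟩ y v = x * s u y v := by
      simpa using congrArg (fun g : I →₀ Module.End R I => ((g y v : I) : R)) h2
    have h1' := congrArg a h1
    have h3' := congrArg a h3
    simp only [map_mul] at h1' h3'
    simp only [q]
    rw [div_mul_eq_mul_div, div_eq_iff (mul_ne_zero hx0' hx0')]
    linear_combination a u * h1' + a x * h3'
  have hqmem (y : I) : q y ∈ (coeSubmodule K I).stableInv := by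
    refine Submodule.mem_stableInv.2 fun m hm n hn => ?_
    obtain ⟨u, hu, rfl⟩ := (mem_coeSubmodule _ _).1 hm
    obtain ⟨v, hv, rfl⟩ := (mem_coeSubmodule _ _).1 hn
    exact (mem_coeSubmodule _ _).2 ⟨_, (s ⟨u, hu⟩ y ⟨v, hv⟩).2, (hq y ⟨u, hu⟩ ⟨v, hv⟩).symm⟩
  have hsum : ∑ y ∈ (s ⟨x, hx⟩).support, a y * q y = 1 := by
    have h4 := hs ⟨x, hx⟩
    rw [Finsupp.linearCombination_apply, Finsupp.sum] at h4
    have h5 := congrArg (fun w : I => a w * a x) h4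
    simp only [id, Module.End.smul_def, AddSubmonoidClass.coe_finsetSum, map_sum,
      Finset.sum_mul] at h5
    have : (∑ y ∈ (s ⟨x, hx⟩).support, a y * q y) * (a x * a x) = 1 * (a x * a x) := by
      rw [one_mul]
      refine Eq.trans ?_ h5
      rw [Finset.sum_mul]
      refine Finset.sum_congr rfl fun y _ => ?_
      rw [mul_assoc, hq y ⟨x, hx⟩ ⟨x, hx⟩, ← map_mul, ← map_mul]
      exact congrArg a (Ideal.end_apply_mul_eq (s ⟨x, hx⟩ y) y ⟨x, hx⟩).symm
    exact mul_right_cancel₀ (mul_ne_zero hx0' hx0') this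
  rw [← hsum]
  exact Submodule.sum_mem _ fun y _ => Submodule.mul_mem_mul
    ((mem_coeSubmodule _ _).2 ⟨y, y.2, rfl⟩) (hqmem y)

theorem Ideal.exists_end_of_mem_div {I : Ideal R} {q : K}
    (hq : q ∈ coeSubmodule K I / coeSubmodule K I) :
    ∃ f : Module.End R I, ∀ z : I, algebraMap R K (f z) = q * algebraMap R K z := by
  have hinj : Function.Injective (algebraMap R K) := IsFractionRing.injective R K
  have (z : I) : ∃ w : I, algebraMap R K w = q * algebraMap R K z := by
    obtain ⟨w, hw, e⟩ := (mem_coeSubmodule _ _).1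
      (Submodule.mem_div_iff_forall_mul_mem.1 hq _ ((mem_coeSubmodule K I).2 ⟨z, z.2, rfl⟩))
    exact ⟨⟨w, hw⟩, e⟩
  choose w hw using this
  refine ⟨⟨⟨w, fun u v => ?_⟩, fun r u => ?_⟩, hw⟩ <;> refine Subtype.ext (hinj ?_)
  · simp only [Submodule.coe_add, map_add, hw, mul_add]
  · simp only [Submodule.coe_smul, smul_eq_mul, map_mul, hw, RingHom.id_apply]
    ring

/-- An ideal that is invertible over its endomorphism ring is stable. -/
theorem Ideal.isStable_of_one_mem {I : Ideal R}
    (h : 1 ∈ coeSubmodule K I * (coeSubmodule K I).stableInv) : I.IsStable := by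
  set a := algebraMap R K
  have hinj : Function.Injective a := IsFractionRing.injective R K
  -- For every `w ∈ I (I : I²)`, multiplication by `w` factors through a free `End_R(I)`-module;
  -- this property is additive in `w`, and the case `w = 1` is projectivity.
  suffices key : ∀ w ∈ coeSubmodule K I * (coeSubmodule K I).stableInv,
      ∃ i : I →ₗ[Module.End R I] I →₀ Module.End R I,
        ∀ z : I, a (Finsupp.linearCombination (Module.End R I) (id : I → I) (i z)) = w * a z by
    obtain ⟨i, hi⟩ := key 1 h
    exact Module.projective_def.2 ⟨i, fun z => Subtype.ext (hinj (by rw [hi, one_mul]))⟩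
  intro w hw
  induction hw using Submodule.mul_induction_on' with
  | add w _ w' _ hw hw' =>
    obtain ⟨i, hi⟩ := hw
    obtain ⟨i', hi'⟩ := hw'
    refine ⟨i + i', fun z => ?_⟩
    rw [LinearMap.add_apply, map_add, Submodule.coe_add, map_add, hi, hi', add_mul]
  | mem_mul_mem x hx q hq =>
    obtain ⟨y, hy, rfl⟩ := (mem_coeSubmodule _ _).1 hx
    have hmul (z : I) : ∃ f : Module.End R I, ∀ v : I, a (f v) = q * a z * a v := by
      refine Ideal.exists_end_of_mem_div K (Submodule.mem_div_iff_forall_mul_mem.2 fun v hv => ?_)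
      rw [mul_assoc]
      exact Submodule.mem_stableInv.1 hq _ ((mem_coeSubmodule _ _).2 ⟨z, z.2, rfl⟩) v hv
    choose F hF using hmul
    let F' : I →ₗ[Module.End R I] Module.End R I :=
      { toFun := F
        map_add' := fun u v => LinearMap.ext fun t => Subtype.ext (hinj (by
          simp only [LinearMap.add_apply, Submodule.coe_add, map_add, hF]
          ring))
        map_smul' := fun f u => LinearMap.ext fun t => Subtype.ext (hinj (by
          obtain ⟨e, he⟩ : ∃ e : K, ∀ z : I, a (f z) = e * a z :=
            Ideal.exists_forall_end_apply_eq K f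
          simp only [Module.End.smul_def, RingHom.id_apply, smul_eq_mul, Module.End.mul_apply,
            hF, he]
          ring)) }
    refine ⟨(Finsupp.lsingle (⟨y, hy⟩ : I)).comp F', fun z => ?_⟩
    have : Finsupp.linearCombination (Module.End R I) (id : I → I)
        ((Finsupp.lsingle (⟨y, hy⟩ : I)).comp F' z) = F z ⟨y, hy⟩ := by
      simp [F']
    rw [this, hF]
    ring

end Stable

/-! ### Divisorial closures in Mori domains -/

section Divisorial

variable {R : Type*} [CommRing R] [IsDomain R]

open IsLocalization

theorem Ideal.vClosure_le_one (I : Ideal R) : I.vClosure ≤ 1 := by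
  have h : (1 : Submodule R (FractionRing R)) ≤ 1 / coeSubmodule _ I :=
    Submodule.one_le_one_div.2 (Ideal.coeSubmodule_le_one _ I)
  refine (Submodule.div_le_div_left 1 h).trans ?_
  rw [← mul_one (1 / 1 : Submodule R (FractionRing R))]
  exact Submodule.le_div_iff_mul_le.1 le_rfl

theorem Ideal.vClosure_mono {I J : Ideal R} (h : I ≤ J) : I.vClosure ≤ J.vClosure :=
  Submodule.div_le_div_left _ (Submodule.div_le_div_left _ (coeSubmodule_mono _ h))

/-- The divisorial closure of an ideal of `R`, as an ideal of `R`. -/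
noncomputable def Ideal.vIdeal (I : Ideal R) : Ideal R :=
  I.vClosure.comap (Algebra.linearMap R (FractionRing R))

theorem Ideal.coeSubmodule_vIdeal (I : Ideal R) :
    coeSubmodule (FractionRing R) I.vIdeal = I.vClosure := by
  refine (Submodule.map_comap_eq _ _).trans (inf_eq_right.2 ?_)
  rw [← Submodule.one_eq_range]
  exact I.vClosure_le_one

theorem Ideal.le_vIdeal (I : Ideal R) : I ≤ I.vIdeal :=
  Submodule.map_le_iff_le_comap.1 (Submodule.le_one_div_one_div _)

theorem Ideal.vIdeal_mono {I J : Ideal R} (h : I ≤ J) : I.vIdeal ≤ J.vIdeal :=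
  Submodule.comap_mono (Ideal.vClosure_mono h)

theorem Ideal.isDivisorial_vIdeal {I : Ideal R} (hI : I ≠ ⊥) : I.vIdeal.IsDivisorial := by
  refine ⟨fun h => hI (le_bot_iff.1 (I.le_vIdeal.trans h.le)), ?_⟩
  rw [Ideal.vClosure, Ideal.coeSubmodule_vIdeal]
  refine le_antisymm (Submodule.le_one_div_one_div _)
    (Submodule.div_le_div_left _ (Submodule.le_one_div_one_div _))

/-- In a Mori domain every nonzero ideal contains a finitely generated ideal with the same
divisorial closure, stated for the duals `(R : J) = (R : I)`. -/
theorem IsMoriDomain.exists_fg_one_div_eq (h : IsMoriDomain R) {I : Ideal R} (hI : I ≠ ⊥) :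
    ∃ J : Ideal R, J ≠ ⊥ ∧ J.FG ∧ J ≤ I ∧
      (1 / coeSubmodule (FractionRing R) J : Submodule R (FractionRing R)) =
        1 / coeSubmodule (FractionRing R) I := by
  have hwf : WellFoundedGT {D : Ideal R // D.IsDivisorial} := by
    rw [wellFoundedGT_iff_monotone_chain_condition]
    intro f
    obtain ⟨n, hn⟩ := h (fun n => f n) (fun _ _ hmn => f.monotone hmn) fun n => (f n).2
    exact ⟨n, fun m hm => Subtype.ext (hn m hm).symm⟩
  obtain ⟨x, hx, hx0⟩ := (Submodule.ne_bot_iff _).1 hI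
  obtain ⟨D, ⟨J, hJ0, hJ, hJI, hD⟩, hmax⟩ := hwf.wf.has_min
    {D | ∃ J : Ideal R, J ≠ ⊥ ∧ J.FG ∧ J ≤ I ∧ D.1 = J.vIdeal}
    ⟨⟨_, Ideal.isDivisorial_vIdeal (mt Ideal.span_singleton_eq_bot.1 hx0)⟩, Ideal.span {x},
      mt Ideal.span_singleton_eq_bot.1 hx0, Submodule.fg_span_singleton x,
      (Ideal.span_singleton_le_iff_mem _).2 hx, rfl⟩
  refine ⟨J, hJ0, hJ, hJI, le_antisymm ?_ (Submodule.div_le_div_left _ (coeSubmodule_mono _ hJI))⟩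
  -- Adjoining an element of `I` to `J` does not enlarge the divisorial closure, by maximality.
  have hIJ : I ≤ J.vIdeal := by
    intro y hy
    have hle : J ≤ J ⊔ Ideal.span {y} := le_sup_left
    have hne : J ⊔ Ideal.span {y} ≠ ⊥ := fun e => hJ0 (le_bot_iff.1 (hle.trans e.le))
    have hnlt := hmax ⟨_, Ideal.isDivisorial_vIdeal hne⟩ ⟨_, hne,
      Submodule.FG.sup hJ (Submodule.fg_span_singleton y),
      sup_le hJI ((Ideal.span_singleton_le_iff_mem _).2 hy), rfl⟩
    have heq : J.vIdeal = (J ⊔ Ideal.span {y}).vIdeal := by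
      refine eq_of_le_of_not_lt (Ideal.vIdeal_mono hle) fun hlt => hnlt ?_
      rw [← hD] at hlt
      exact hlt
    rw [heq]
    exact Ideal.le_vIdeal _ ((le_sup_right : Ideal.span {y} ≤ _) (Ideal.mem_span_singleton_self y))
  refine (Submodule.le_one_div_one_div _).trans (Submodule.div_le_div_left 1 ?_)
  exact (coeSubmodule_mono _ hIJ).trans J.coeSubmodule_vIdeal.le

end Divisorial

/-! ### Finitely stable one-dimensional Mori domains -/

theorem mainTheorem10 (R : Type*) [CommRing R] [IsDomain R] (hdim : ringKrullDim R = 1)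
    (hfs : IsFinitelyStableDomain R) (hMori : IsMoriDomain R) : IsStableDomain R := by
  intro I hI
  have : Ring.KrullDimLE 1 R := (Order.krullDimLE_iff _ _).2 hdim.le
  have : Ring.DimensionLEOne R := ⟨fun hp hP => hP.isMaximal_of_ne_bot hp⟩
  let K := FractionRing R
  have hinj : Function.Injective (algebraMap R K) := IsFractionRing.injective R K
  have hbot {J : Ideal R} : IsLocalization.coeSubmodule K J = ⊥ ↔ J = ⊥ := by
    rw [← IsLocalization.coeSubmodule_bot (R := R) K]
    exact (IsFractionRing.coeSubmodule_injective R K).eq_iff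
  obtain ⟨J₀, h0, hfg, hle, hD⟩ := hMori.exists_fg_one_div_eq hI
  refine Ideal.isStable_of_one_mem K (Submodule.one_mem_mul_stableInv_of_fg (mt hbot.1 h0)
    ((IsLocalization.coeSubmodule_fg K hinj _).2 hfg) (IsLocalization.coeSubmodule_mono K hle)
    (I.coeSubmodule_le_one K) hD fun J hJ0 hJI hJ => ?_)
  -- Every submodule of `I` is the image of an ideal of `R`.
  have hJe : IsLocalization.coeSubmodule K (J.comap (Algebra.linearMap R K)) = J := by
    refine (Submodule.map_comap_eq _ _).trans (inf_eq_right.2 ?_)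
    rw [← Submodule.one_eq_range]
    exact hJI.trans (I.coeSubmodule_le_one K)
  have hne : J.comap (Algebra.linearMap R K) ≠ ⊥ := fun e => hJ0 (hJe ▸ hbot.2 e)
  have hst := hfs _ hne ((IsLocalization.coeSubmodule_fg K hinj _).1 (by rwa [hJe]))
  simpa only [hJe] using hst.one_mem K hne
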